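/- **Rotting bandit.** Let $\mathcal A$ be an infinite set of arms whose initial mean rewards $\mu_1(a)$, $a\in\mathcal A$, are i.i.d. uniform on $[0,1]$. In each round $t=1,\dots,T$ a policy pulls an arm $a_t$ and obtains the reward $r_t=\mu_t(a_t)+\eta_t$, where the noise $\eta_t$ is $1$-sub-Gaussian given the past, the past including all the initial mean rewards: $\mathbb E[e^{\lambda\eta_t}\mid \text{past}]\le e^{\lambda^2/2}$ for all $\lambda\in\mathbb R$ (for example, the $\eta_t$ are independent, centred and $1$-sub-Gaussian, and independent of the initial mean rewards). Then the mean reward of the pulled arm decreases, $\mu_{t+1}(a_t)=\mu_t(a_t)-\varrho_t$, and those of the other arms do not change. Here $(\varrho_t)_{t\ge1}$ is an arbitrary sequence of rotting rates with $0\le\varrho_t\le\varrho$, which may even be chosen adaptively ($\varrho_t$ may depend on everything that happened up to round $t$, and on the initial mean rewards). The regret is $R(T)=\sum_{t=1}^T(1-\mu_t(a_t))$. **UCB-Threshold Policy.** The policy knows $T$ and $\varrho$ and uses the threshold parameter $\delta=\max\{\varrho^{1/3},1/\sqrt T\}$. Put $n_t(a)=\sum_{s=1}^{t-1}\mathbf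 1(a_s=a)$, $$\tilde\mu_t^o(a)=\frac{\sum_{s=1}^{t-1}(r_s+\varrho\, n_s(a))\mathbf 1(a_s=a)}{n_t(a)},\qquad \mathrm{UCB}_t(a)=\tilde\mu^o_t(a)-\varrho\, n_t(a)+\sqrt{\frac{10\log T}{n_t(a)}} .$$ In round $1$ it selects an arm and pulls it. In round $t\ge2$, if $a=a_{t-1}$ satisfies $\mathrm{UCB}_t(a)\ge1-\delta$, then it pulls $a$ again; otherwise it discards $a$ for good, selects an arm that has not been discarded (by any fixed rule that looks only at the set of discarded arms), and pulls it. **Theorem.** If the maximum rotting rate satisfies $\varrho=\varrho(T)\ge0$ and $\varrho=o(1)$ as $T\to\infty$, then the UCB-Threshold Policy satisfies $$\mathbb E[R(T)]=\tilde O\big(\max\{\varrho^{1/3}T,\sqrt T\}\big).$$ That is, there are absolute constants $C>0$ and $k\in\mathbb N$ such that for every function $\varrho(\cdot)\ge0$ with $\varrho(T)\to0$ there is a $T_0$ such that, for all $T\ge T_0$ and all bandits as above with maximum rotting rate $\varrho=\varrho(T)$, $R(T)$ is integrable and $\mathbb E[R(T)]\le C(\log T)^k\max\{\varrho^{1/3}T,\sqrt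 T\}$. -/

import Mathlib

open MeasureTheory ProbabilityTheory Filter Topology

namespace RottingBandits

noncomputable section

/-- The observations available to a policy before a round: the pairs (pulled arm, obtained reward)
of the previous rounds, with the most recent round at the head of the list. -/
abbrev History (𝒜 : Type*) := List (𝒜 × ℝ)

/-- `n_t(a)`: the number of times arm `a` was pulled in the history. -/
def pullCount {𝒜 : Type*} (a : 𝒜) (h : History 𝒜) : ℕ :=
  open scoped Classical in h.countP (fun p => p.1 = a)

/-- `∑_{s < t} (r_s + ϱ n_s(a)) 1(a_s = a)`. In the recursive clause, the tail `h` is the history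
before the round of the head, so that `pullCount a h` is `n_s(a)` for that round. -/
def correctedSum {𝒜 : Type*} (ϱ : ℝ) (a : 𝒜) : History 𝒜 → ℝ
  | [] => 0
  | p :: h => open scoped Classical in
      correctedSum ϱ a h + (if p.1 = a then p.2 + ϱ * (pullCount a h : ℝ) else 0)

/-- The estimator of the initial mean reward of arm `a`. -/
def initialMeanEstimator {𝒜 : Type*} (ϱ : ℝ) (a : 𝒜) (h : History 𝒜) : ℝ :=
  correctedSum ϱ a h / (pullCount a h : ℝ)

/-- The rotting-corrected upper confidence bound `UCB_t(a)` for horizon `T`. -/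
def ucbIndex {𝒜 : Type*} (T : ℕ) (ϱ : ℝ) (a : 𝒜) (h : History 𝒜) : ℝ :=
  initialMeanEstimator ϱ a h - ϱ * (pullCount a h : ℝ)
    + √(10 * Real.log (T : ℝ) / (pullCount a h : ℝ))

/-- The set of the arms that were selected so far. -/
def selectedArms {𝒜 : Type*} (h : History 𝒜) : Finset 𝒜 :=
  open scoped Classical in (h.map Prod.fst).toFinset

/-- The UCB-Threshold Policy with threshold parameter `δ`. In the first round it selects an
arm. Later it keeps the arm `a` of the previous round as long as `UCB_t(a) ≥ 1 - δ`; otherwise `a`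
is discarded and a new arm is selected among the arms that remain. When a new arm is needed, all
the arms selected so far have been discarded. `select D` is the arm that is selected when `D` is
the set of discarded arms. -/
def ucbThresholdPolicy {𝒜 : Type*} (select : Finset 𝒜 → 𝒜) (T : ℕ) (ϱ δ : ℝ) :
    History 𝒜 → 𝒜
  | [] => select ∅
  | p :: h => open scoped Classical in
      if 1 - δ ≤ ucbIndex T ϱ p.1 (p :: h) then p.1 else select (selectedArms (p :: h))

/-- The threshold parameter `max {ϱ^{1/3}, 1/√T}`. -/
def threshold (T : ℕ) (ϱ : ℝ) : ℝ :=
  max (ϱ ^ (1 / 3 : ℝ)) (1 / √(T : ℝ))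

/-- What holds between two rounds: the observations so far, and the current mean rewards. -/
structure State (𝒜 : Type*) where
  history : History 𝒜
  mean : 𝒜 → ℝ

/-- The evolution under the policy `π`, for given initial mean rewards `μ₁`, rotting rates
`ρ 1, ρ 2, …` and noise `η 1, η 2, …`: `trajectory π μ₁ ρ η t` is the state after `t` rounds.
In round `t + 1` the arm `a = π history` is pulled, the reward is `mean a + η (t + 1)`, and then the
mean reward of `a` decreases by `ρ (t + 1)`, the other mean rewards being unchanged. -/
def trajectory {𝒜 : Type*} (π : History 𝒜 → 𝒜) (μ₁ : 𝒜 → ℝ) (ρ η : ℕ → ℝ) : ℕ → State 𝒜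
  | 0 => ⟨[], μ₁⟩
  | t + 1 => open scoped Classical in
      let S := trajectory π μ₁ ρ η t
      let a := π S.history
      ⟨(a, S.mean a + η (t + 1)) :: S.history, Function.update S.mean a (S.mean a - ρ (t + 1))⟩

/-- The regret `∑_{t=1}^T (1 - μ_t(a_t))`. The summand with index `t` is the one of round `t + 1`. -/
def regret {𝒜 : Type*} (π : History 𝒜 → 𝒜) (μ₁ : 𝒜 → ℝ) (ρ η : ℕ → ℝ) (T : ℕ) : ℝ :=
  ∑ t ∈ Finset.range T,
    (1 - (trajectory π μ₁ ρ η t).mean (π (trajectory π μ₁ ρ η t).history))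

/-- A rested rotting bandit environment with set of arms `𝒜` and maximum rotting rate `ϱ`, on the
probability space `(Ω, P)`. The σ-algebra `ℱ t` is the information after round `t` (`ℱ 0`: before
the first round). The rotting rate of round `t` may be an arbitrary function of what happened up to
round `t`. The noise of a round is `1`-sub-Gaussian given the past; this covers independent
centred `1`-sub-Gaussian noise variables that are independent of the initial mean rewards. -/
structure Environment {Ω : Type*} [mΩ : MeasurableSpace Ω] (P : Measure Ω) (𝒜 : Type*)
    (ϱ : ℝ) where
  ℱ : Filtration ℕ mΩ
  /-- the initial mean rewards `μ₁(a)` -/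
  initialMean : 𝒜 → Ω → ℝ
  /-- the rotting rates `ϱ_t`, for `t ≥ 1` -/
  rotting : ℕ → Ω → ℝ
  /-- the noise terms `η_t`, for `t ≥ 1` -/
  noise : ℕ → Ω → ℝ
  measurable_initialMean : ∀ a, Measurable[ℱ 0] (initialMean a)
  uniform_initialMean : ∀ a, pdf.IsUniform (initialMean a) (Set.Icc (0 : ℝ) 1) P volume
  indep_initialMean : iIndepFun initialMean P
  measurable_rotting : ∀ t, 1 ≤ t → Measurable[ℱ t] (rotting t)
  rotting_nonneg : ∀ t, 1 ≤ t → ∀ ω, 0 ≤ rotting t ω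
  rotting_le : ∀ t, 1 ≤ t → ∀ ω, rotting t ω ≤ ϱ
  measurable_noise : ∀ t, 1 ≤ t → Measurable[ℱ t] (noise t)
  integrable_exp_noise : ∀ t, 1 ≤ t → ∀ l : ℝ, Integrable (fun ω => Real.exp (l * noise t ω)) P
  subGaussian_noise : ∀ (t : ℕ) (l : ℝ),
    P[fun ω => Real.exp (l * noise (t + 1) ω) | ℱ t] ≤ᵐ[P] fun _ => Real.exp (l ^ 2 / 2)

/-- The regret over the horizon `T`, as a random variable, of the UCB-Threshold Policy that knows
`ϱ` and uses the threshold parameter `max {ϱ^{1/3}, 1/√T}`. -/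
def ucbThresholdRegret {Ω : Type*} [MeasurableSpace Ω] {P : Measure Ω} {𝒜 : Type*} {ϱ : ℝ}
    (E : Environment P 𝒜 ϱ) (select : Finset 𝒜 → 𝒜) (T : ℕ) (ω : Ω) : ℝ :=
  regret (ucbThresholdPolicy select T ϱ (threshold T ϱ)) (fun a => E.initialMean a ω)
    (fun t => E.rotting t ω) (fun t => E.noise t ω) T

end

end RottingBandits

/-!
The arms are selected in an order `b 0, b 1, …` that depends on the selection rule only, and every
arm is pulled in one block of consecutive rounds. So the regret is a function of the process
`indexRun`, which records the index of the current arm, its number of pulls, its corrected sum of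
rewards and its current mean reward (`regret_eq_sum_indexRun`). Write `L = log T`, let `δ` be the
threshold parameter, and call `1 - u k` the gap of the arm `b k` with initial mean reward `u k`.

Suppose that the noise over every block of `n` rounds is at most `√(10 L n)` in absolute value. Then
after `n` pulls of an arm the index lies between its initial mean reward minus `ϱ n` and its current
mean reward plus `2 √(10 L / n)`. The upper bound shows that a round in which an arm is kept costs at
most `δ + 2 √(10 L / n)`, and that an arm of gap `Δ ≥ 2 δ` is kept for `O(L / Δ ^ 2)` rounds only.
Hence the arm costs at most `2 δ` per pull plus `1 + O(L / (Δ + δ))`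
(`sum_truncatedWidth_le`, `sum_one_sub_mean_le`). The lower bound shows that a good arm, one with
`Δ ≤ δ / 2`, is discarded only after `n` pulls with `ϱ n > δ / 2`; since `ϱ ≤ δ ^ 3`, at most
`2 T δ ^ 2` good arms are discarded (`goodCount_arm_le`). If there are more good arms than that among
the first `K`, then only the first `K` arms are pulled (`sum_one_sub_mean_le_of_goodCount`).

The assumption on the noise fails with probability at most `2 / T ^ 2` by Chernoff's bound for sums of
conditionally sub-Gaussian variables (`measureReal_not_noiseControlled_le`). A given arm is good with
probability `δ / 2`, so for some `K` of order `δ T L` the first `K` arms contain too few good arms with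
probability at most `1 / T ^ 2` (`measureReal_goodCount_le`). On these two events the regret is still
at most `2 T ^ 2` (`sum_one_sub_mean_le_crude`), so they contribute a constant. As the gaps are
uniform, `L / (Δ + δ)` has expectation `O(L ^ 2)` (`integral_one_div_gap`), and the expected regret is
at most `2 δ T + O(K L ^ 2) + O(1) = O(L ^ 3 δ T)`, where `δ T` is the maximum in the statement.
-/

namespace RottingBandits

/-! ### Reduction to a process on arm indices -/

section Reduction

variable {𝒜 : Type*}

open scoped Classical in
/-- The set of the first `n` arms in the order in which the policy selects them. It is the set of
discarded arms when the arm number `n` (counted from `0`) is selected. -/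
noncomputable def discardedSet (select : Finset 𝒜 → 𝒜) : ℕ → Finset 𝒜
  | 0 => ∅
  | n + 1 => insert (select (discardedSet select n)) (discardedSet select n)

/-- The `n`-th arm (counted from `0`) that the policy selects; it depends on the selection rule
only. -/
noncomputable def selectedArm (select : Finset 𝒜 → 𝒜) (n : ℕ) : 𝒜 :=
  select (discardedSet select n)

lemma mem_discardedSet (select : Finset 𝒜 → 𝒜) (n : ℕ) (a : 𝒜) :
    a ∈ discardedSet select n ↔ ∃ j < n, a = selectedArm select j := by
  classical
  induction n with
  | zero => simp [discardedSet]
  | succ n ih =>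
    simp only [discardedSet, Finset.mem_insert, ih, Nat.lt_succ_iff_lt_or_eq]
    constructor
    · rintro (h | ⟨j, hj, h⟩)
      · exact ⟨n, Or.inr rfl, h⟩
      · exact ⟨j, Or.inl hj, h⟩
    · rintro ⟨j, hj | rfl, h⟩
      · exact Or.inr ⟨j, hj, h⟩
      · exact Or.inl h

lemma selectedArm_injective {select : Finset 𝒜 → 𝒜} (hsel : ∀ D, select D ∉ D) :
    Function.Injective (selectedArm select) := by
  have key : ∀ i j, i < j → selectedArm select i ≠ selectedArm select j := fun i j hij h =>
    hsel (discardedSet select j) ((mem_discardedSet select j _).2 ⟨i, hij, h.symm⟩)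
  intro i j h
  rcases lt_trichotomy i j with hij | hij | hij
  · exact absurd h (key i j hij)
  · exact hij
  · exact absurd h.symm (key j i hij)

/-- The upper confidence bound of an arm that was pulled `n` times and whose corrected sum of
rewards is `s`. -/
noncomputable def ucbValue (T : ℕ) (ϱ : ℝ) (n : ℕ) (s : ℝ) : ℝ :=
  s / (n : ℝ) - ϱ * (n : ℝ) + √(10 * Real.log (T : ℝ) / (n : ℝ))

/-- What matters for the rest of the run just before a round: the index of the arm that is about to
be pulled, how often it was pulled, its corrected sum of rewards, and its current mean reward. -/
structure IndexState where
  arm : ℕ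
  pulls : ℕ
  sum : ℝ
  mean : ℝ

/-- The run of the policy in terms of `IndexState`, where `u k` is the initial mean reward of the
`k`-th arm that is selected. `indexRun T ϱ δ u ρ η t` is the state in which round `t + 1` starts;
the choice of the arm for that round is already made. -/
noncomputable def indexRun (T : ℕ) (ϱ δ : ℝ) (u ρ η : ℕ → ℝ) : ℕ → IndexState
  | 0 => ⟨0, 0, 0, u 0⟩
  | t + 1 =>
      let S := indexRun T ϱ δ u ρ η t
      let s := S.sum + (S.mean + η (t + 1) + ϱ * (S.pulls : ℝ))
      if 1 - δ ≤ ucbValue T ϱ (S.pulls + 1) s then ⟨S.arm, S.pulls + 1, s, S.mean - ρ (t + 1)⟩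
      else ⟨S.arm + 1, 0, 0, u (S.arm + 1)⟩

lemma pullCount_cons_self (a : 𝒜) (r : ℝ) (h : History 𝒜) :
    pullCount a ((a, r) :: h) = pullCount a h + 1 := by
  simp [pullCount]

lemma pullCount_eq_zero {a : 𝒜} {h : History 𝒜} (ha : a ∉ selectedArms h) : pullCount a h = 0 := by
  simp only [selectedArms, List.mem_toFinset, List.mem_map, not_exists, not_and] at ha
  simp only [pullCount, List.countP_eq_zero, decide_eq_true_eq]
  exact fun p hp => ha p hp

lemma correctedSum_eq_zero (ϱ : ℝ) {a : 𝒜} {h : History 𝒜} (ha : a ∉ selectedArms h) :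
    correctedSum ϱ a h = 0 := by
  induction h with
  | nil => rfl
  | cons p h ih =>
    have h1 : p.1 ≠ a := by
      rintro rfl
      exact ha (by simp [selectedArms])
    have h2 : a ∉ selectedArms h := by
      intro hm
      apply ha
      simp only [selectedArms, List.map_cons, List.toFinset_cons, Finset.mem_insert]
      exact Or.inr (by simpa [selectedArms] using hm)
    simp [correctedSum, h1, ih h2]

/-- The correspondence between a state of the bandit and an `IndexState`. The field `selected` says
that the arms selected so far, together with the arm about to be pulled (which may be new), are the
first `I.arm + 1` arms. -/
structure Matches (select : Finset 𝒜 → 𝒜) (π : History 𝒜 → 𝒜) (ϱ : ℝ) (μ₁ : 𝒜 → ℝ)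
    (S : State 𝒜) (I : IndexState) : Prop where
  arm : π S.history = selectedArm select I.arm
  pulls : pullCount (selectedArm select I.arm) S.history = I.pulls
  sum : correctedSum ϱ (selectedArm select I.arm) S.history = I.sum
  mean : S.mean (selectedArm select I.arm) = I.mean
  mean_later : ∀ j, I.arm < j → S.mean (selectedArm select j) = μ₁ (selectedArm select j)
  selected : insert (selectedArm select I.arm) (selectedArms S.history : Set 𝒜)
    = discardedSet select (I.arm + 1)

lemma matches_indexRun {select : Finset 𝒜 → 𝒜} (hsel : ∀ D, select D ∉ D) (T : ℕ) (ϱ δ : ℝ)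
    (μ₁ : 𝒜 → ℝ) (ρ η : ℕ → ℝ) (t : ℕ) :
    Matches select (ucbThresholdPolicy select T ϱ δ) ϱ μ₁
      (trajectory (ucbThresholdPolicy select T ϱ δ) μ₁ ρ η t)
      (indexRun T ϱ δ (fun k => μ₁ (selectedArm select k)) ρ η t) := by
  classical
  have hinj := selectedArm_injective hsel
  induction t with
  | zero =>
    refine ⟨rfl, rfl, rfl, rfl, fun j _ => rfl, ?_⟩
    simp [trajectory, selectedArms, indexRun, discardedSet, selectedArm]
  | succ t ih =>
    set π := ucbThresholdPolicy select T ϱ δ with hπ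
    set S := trajectory π μ₁ ρ η t with hS
    set I := indexRun T ϱ δ (fun k => μ₁ (selectedArm select k)) ρ η t with hI
    set a := selectedArm select I.arm with ha
    set s := I.sum + (I.mean + η (t + 1) + ϱ * (I.pulls : ℝ)) with hs
    have iharm : π S.history = a := ih.arm
    have ihpulls : pullCount a S.history = I.pulls := ih.pulls
    have ihsum : correctedSum ϱ a S.history = I.sum := ih.sum
    have ihmean : S.mean a = I.mean := ih.mean
    have ihsel : insert a (selectedArms S.history : Set 𝒜) = discardedSet select (I.arm + 1) :=
      ih.selected
    have htraj : trajectory π μ₁ ρ η (t + 1)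
        = ⟨(a, I.mean + η (t + 1)) :: S.history, Function.update S.mean a (I.mean - ρ (t + 1))⟩ := by
      simp only [trajectory, ← hS, iharm, ihmean]
    set h' : History 𝒜 := (a, I.mean + η (t + 1)) :: S.history with hh'
    have hcount : pullCount a h' = I.pulls + 1 := by rw [hh', pullCount_cons_self, ihpulls]
    have hsum : correctedSum ϱ a h' = s := by
      simp only [hh', correctedSum, if_true, ihsum, ihpulls, hs]
    have hsel' : (selectedArms h' : Set 𝒜) = discardedSet select (I.arm + 1) := by
      rw [← ihsel]
      ext x
      simp [selectedArms, hh']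
    have hucb : ucbIndex T ϱ a h' = ucbValue T ϱ (I.pulls + 1) s := by
      simp only [ucbIndex, initialMeanEstimator, ucbValue, hcount, hsum]
    have hpol : π h' = if 1 - δ ≤ ucbValue T ϱ (I.pulls + 1) s then a
        else selectedArm select (I.arm + 1) := by
      have : selectedArms h' = discardedSet select (I.arm + 1) := by exact_mod_cast hsel'
      rw [← hucb, selectedArm, ← this]
      simp only [hπ, hh', ucbThresholdPolicy]
    have hne : ∀ j, I.arm < j → selectedArm select j ≠ a := fun j hj h => hj.ne' (hinj h)
    rw [htraj]
    simp only [indexRun, ← hI, ← hs]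
    split_ifs at hpol ⊢ with hc
    · refine ⟨hpol, hcount, hsum, by simp [← ha], fun j hj => ?_, ?_⟩
      · simp only at hj ⊢
        rw [Function.update_of_ne (hne j hj), ih.mean_later j hj]
      · rw [hsel', ← ha]
        apply Set.insert_eq_of_mem
        exact_mod_cast (mem_discardedSet select _ _).2 ⟨I.arm, Nat.lt_succ_self _, ha⟩
    · have hnot : selectedArm select (I.arm + 1) ∉ selectedArms h' := by
        have : selectedArms h' = discardedSet select (I.arm + 1) := by exact_mod_cast hsel'
        rw [this]
        exact hsel _
      refine ⟨hpol, pullCount_eq_zero hnot, correctedSum_eq_zero ϱ hnot, ?_, fun j hj => ?_, ?_⟩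
      · simp only
        rw [Function.update_of_ne (hne _ (Nat.lt_succ_self _)),
          ih.mean_later _ (Nat.lt_succ_self _)]
      · simp only at hj ⊢
        rw [Function.update_of_ne (hne j (by omega)), ih.mean_later j (by omega)]
      · rw [hsel']
        simp only [discardedSet, selectedArm, Finset.coe_insert]

/-- The regret depends on the bandit only through the process on arm indices, which is measurable
without any structure on the set of arms. -/
lemma regret_eq_sum_indexRun {select : Finset 𝒜 → 𝒜} (hsel : ∀ D, select D ∉ D) (T : ℕ) (ϱ δ : ℝ)
    (μ₁ : 𝒜 → ℝ) (ρ η : ℕ → ℝ) :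
    regret (ucbThresholdPolicy select T ϱ δ) μ₁ ρ η T
      = ∑ t ∈ Finset.range T,
          (1 - (indexRun T ϱ δ (fun k => μ₁ (selectedArm select k)) ρ η t).mean) := by
  refine Finset.sum_congr rfl fun t _ => ?_
  have h := matches_indexRun hsel T ϱ δ μ₁ ρ η t
  rw [h.arm, h.mean]

end Reduction

lemma measurable_indexRun {Ω : Type*} [MeasurableSpace Ω] (T : ℕ) (ϱ δ : ℝ) {u ρ η : ℕ → Ω → ℝ}
    (hu : ∀ k, Measurable (u k)) (hρ : ∀ t, 1 ≤ t → Measurable (ρ t))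
    (hη : ∀ t, 1 ≤ t → Measurable (η t)) (t : ℕ) :
    (Measurable fun ω => (indexRun T ϱ δ (u · ω) (ρ · ω) (η · ω) t).arm) ∧
    (Measurable fun ω => (indexRun T ϱ δ (u · ω) (ρ · ω) (η · ω) t).pulls) ∧
    (Measurable fun ω => (indexRun T ϱ δ (u · ω) (ρ · ω) (η · ω) t).sum) ∧
    (Measurable fun ω => (indexRun T ϱ δ (u · ω) (ρ · ω) (η · ω) t).mean) := by
  induction t with
  | zero => exact ⟨measurable_const, measurable_const, measurable_const, hu 0⟩
  | succ t ih =>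
    obtain ⟨h1, h2, h3, h4⟩ := ih
    have hη' := hη (t + 1) (Nat.le_add_left 1 t)
    have hρ' := hρ (t + 1) (Nat.le_add_left 1 t)
    set I := fun ω => indexRun T ϱ δ (u · ω) (ρ · ω) (η · ω) t with hI
    have h2' : Measurable fun ω => ((I ω).pulls : ℝ) := (measurable_from_nat (f := Nat.cast)).comp h2
    have hs : Measurable fun ω => (I ω).sum + ((I ω).mean + η (t + 1) ω + ϱ * ((I ω).pulls : ℝ)) :=
      h3.add ((h4.add hη').add (h2'.const_mul ϱ))
    have hc : MeasurableSet {ω | 1 - δ ≤ ucbValue T ϱ ((I ω).pulls + 1)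
        ((I ω).sum + ((I ω).mean + η (t + 1) ω + ϱ * ((I ω).pulls : ℝ)))} := by
      refine measurableSet_le measurable_const ?_
      simp only [ucbValue, Nat.cast_add, Nat.cast_one]
      have := h2'.add_const 1
      exact ((hs.div this).sub (this.const_mul ϱ)).add ((this.const_div _).sqrt)
    have hu' : Measurable fun ω => u ((I ω).arm + 1) ω :=
      (measurable_from_prod_countable_right (f := fun p : ℕ × Ω => u (p.1 + 1) p.2)
        (fun k => hu (k + 1))).comp (h1.prodMk measurable_id)
    refine ⟨?_, ?_, ?_, ?_⟩
    · simp only [indexRun, apply_ite IndexState.arm]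
      exact Measurable.ite hc h1 (h1.add_const 1)
    · simp only [indexRun, apply_ite IndexState.pulls]
      exact Measurable.ite hc (h2.add_const 1) measurable_const
    · simp only [indexRun, apply_ite IndexState.sum]
      exact Measurable.ite hc hs measurable_const
    · simp only [indexRun, apply_ite IndexState.mean]
      exact Measurable.ite hc (h4.sub hρ') hu'

/-! ### Pathwise analysis of the run -/

lemma sum_one_div_sqrt_le (n : ℕ) : ∑ i ∈ Finset.range n, 1 / √((i : ℝ) + 1) ≤ 2 * √(n : ℝ) := by
  induction n with
  | zero => simp
  | succ n ih =>
    rw [Finset.sum_range_succ]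
    push_cast
    have h1 : 0 < √((n : ℝ) + 1) := Real.sqrt_pos.2 (by positivity)
    have h2 : √((n : ℝ) + 1) ^ 2 = n + 1 := Real.sq_sqrt (by positivity)
    have h3 : √(n : ℝ) ^ 2 = n := Real.sq_sqrt (by positivity)
    have : 1 / √((n : ℝ) + 1) ≤ 2 * √((n : ℝ) + 1) - 2 * √(n : ℝ) := by
      rw [div_le_iff₀ h1]
      nlinarith [sq_nonneg (√((n : ℝ) + 1) - √(n : ℝ))]
    linarith

/-- Twice the confidence width after `i` pulls if that is at least `M`, and `0` otherwise; the
value at `i = 0` is `1`, which bounds the regret of the first pull of an arm. -/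
noncomputable def truncatedWidth (L M : ℝ) (i : ℕ) : ℝ :=
  if i = 0 then 1 else if M ≤ 2 * √(10 * L / i) then 2 * √(10 * L / i) else 0

/-- Only the first `40 L / M ^ 2` widths are at least `M`, and the sum of the first `m` widths is of
order `√(L m)`. -/
lemma sum_truncatedWidth_le {L M : ℝ} (hL : 0 ≤ L) (hM : 0 < M) (n : ℕ) :
    ∑ i ∈ Finset.range n, truncatedWidth L M i ≤ 1 + 80 * L / M := by
  rcases n with _ | n
  · simp; positivity
  rw [Finset.sum_range_succ', add_comm]
  have h0 : truncatedWidth L M 0 = 1 := by simp [truncatedWidth]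
  rw [h0]
  gcongr
  set m := ⌊40 * L / M ^ 2⌋₊ with hm
  -- A width of at least `M` after `i + 1` pulls forces `i + 1 ≤ 40 L / M ^ 2`.
  have key : ∀ i : ℕ, truncatedWidth L M (i + 1)
      ≤ if i < m then 2 * √(10 * L) * (1 / √((i : ℝ) + 1)) else 0 := by
    intro i
    have hi : (0 : ℝ) < (i : ℝ) + 1 := by positivity
    have hw : 2 * √(10 * L / ((i + 1 : ℕ) : ℝ)) = 2 * √(10 * L) * (1 / √((i : ℝ) + 1)) := by
      push_cast
      rw [Real.sqrt_div (by positivity)]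
      ring
    simp only [truncatedWidth, Nat.add_eq_zero_iff, one_ne_zero, and_false, if_false]
    by_cases hc : M ≤ 2 * √(10 * L / ((i + 1 : ℕ) : ℝ))
    · have hlt : i < m := by
        rw [hm, Nat.lt_iff_add_one_le, Nat.le_floor_iff (by positivity), le_div_iff₀ (by positivity)]
        have h1 := pow_le_pow_left₀ hM.le hc 2
        rw [mul_pow, Real.sq_sqrt (by positivity)] at h1
        push_cast at h1 ⊢
        rw [mul_div_assoc', le_div_iff₀ hi] at h1
        linarith
      rw [if_pos hc, if_pos hlt, hw]
    · rw [if_neg hc]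
      split_ifs <;> positivity
  calc ∑ i ∈ Finset.range n, truncatedWidth L M (i + 1)
      ≤ ∑ i ∈ Finset.range n, if i < m then 2 * √(10 * L) * (1 / √((i : ℝ) + 1)) else 0 :=
        Finset.sum_le_sum fun i _ => key i
    _ = ∑ i ∈ (Finset.range n).filter (· < m), 2 * √(10 * L) * (1 / √((i : ℝ) + 1)) := by
        rw [Finset.sum_filter]
    _ ≤ ∑ i ∈ Finset.range m, 2 * √(10 * L) * (1 / √((i : ℝ) + 1)) := by
        refine Finset.sum_le_sum_of_subset_of_nonneg (fun i hi => ?_) fun i _ _ => by positivity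
        simpa using (Finset.mem_filter.1 hi).2
    _ = 2 * √(10 * L) * ∑ i ∈ Finset.range m, 1 / √((i : ℝ) + 1) := by rw [Finset.mul_sum]
    _ ≤ 2 * √(10 * L) * (2 * √(m : ℝ)) := by gcongr; exact sum_one_div_sqrt_le m
    _ ≤ 2 * √(10 * L) * (2 * √(40 * L / M ^ 2)) := by
        gcongr
        exact Nat.floor_le (by positivity)
    _ = 80 * L / M := by
        have h4 : √(40 * L / M ^ 2) = 2 * √(10 * L) / M := by
          rw [Real.sqrt_div (by positivity), Real.sqrt_sq hM.le,
            show 40 * L = 2 ^ 2 * (10 * L) by ring, Real.sqrt_mul (by positivity),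
            Real.sqrt_sq (by norm_num)]
        rw [h4]
        have := Real.mul_self_sqrt (show 0 ≤ 10 * L by positivity)
        field_simp
        nlinarith

section Pathwise

variable (T : ℕ) (ϱ δ : ℝ) (u ρ η : ℕ → ℝ)

/-- The sum of the noise terms of the rounds `s + 1, …, t`. -/
def noiseSum (s t : ℕ) : ℝ := ∑ i ∈ Finset.Ico s t, η (i + 1)

/-- The invariants of the run that hold for every noise. `noiseSum η (t - n) t` is the noise of the
`n` rounds in which the current arm was pulled; they are the last `n` rounds. -/
structure RunInvariant (t : ℕ) (I : IndexState) : Prop where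
  pulls_le : I.pulls ≤ t
  mean_le : I.mean ≤ u I.arm
  le_mean : u I.arm - ϱ * I.pulls ≤ I.mean
  le_sum : I.pulls * u I.arm + noiseSum η (t - I.pulls) t ≤ I.sum
  sum_le : I.sum ≤ I.pulls * (I.mean + ϱ * I.pulls) + noiseSum η (t - I.pulls) t
  kept : I.pulls ≠ 0 → 1 - δ ≤ ucbValue T ϱ I.pulls I.sum

variable {T ϱ δ u ρ η}

lemma noiseSum_succ (t n : ℕ) :
    noiseSum η (t + 1 - (n + 1)) (t + 1) = noiseSum η (t - n) t + η (t + 1) := by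
  rw [noiseSum, noiseSum, Nat.add_sub_add_right, Finset.sum_Ico_succ_top (Nat.sub_le _ _)]

/-- After one more pull, the corrected sum of rewards is bounded below by the initial mean reward
and above by the current one. -/
lemma RunInvariant.sum_bounds {t : ℕ} {I : IndexState} (h : RunInvariant T ϱ δ u η t I)
    (hρ1 : ρ (t + 1) ≤ ϱ) :
    ((I.pulls + 1 : ℕ) : ℝ) * u I.arm + noiseSum η (t + 1 - (I.pulls + 1)) (t + 1)
        ≤ I.sum + (I.mean + η (t + 1) + ϱ * I.pulls) ∧
      I.sum + (I.mean + η (t + 1) + ϱ * I.pulls)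
        ≤ ((I.pulls + 1 : ℕ) : ℝ) * (I.mean - ρ (t + 1) + ϱ * ((I.pulls + 1 : ℕ) : ℝ))
          + noiseSum η (t + 1 - (I.pulls + 1)) (t + 1) := by
  rw [noiseSum_succ]
  have h1 := h.le_mean
  have h2 := h.le_sum
  have h3 := h.sum_le
  push_cast
  refine ⟨by linarith, ?_⟩
  have : 0 ≤ ((I.pulls : ℝ) + 1) * (ϱ - ρ (t + 1)) :=
    mul_nonneg (by positivity) (by linarith)
  nlinarith

lemma runInvariant_indexRun (hρ0 : ∀ t, 1 ≤ t → 0 ≤ ρ t) (hρ1 : ∀ t, 1 ≤ t → ρ t ≤ ϱ) (t : ℕ) :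
    RunInvariant T ϱ δ u η t (indexRun T ϱ δ u ρ η t) := by
  induction t with
  | zero => constructor <;> simp [indexRun, noiseSum]
  | succ t ih =>
    set I := indexRun T ϱ δ u ρ η t with hI
    have h0 := hρ0 (t + 1) (Nat.le_add_left 1 t)
    have h1 := hρ1 (t + 1) (Nat.le_add_left 1 t)
    have hb := ih.sum_bounds h1
    simp only [indexRun, ← hI]
    split_ifs with hc
    · refine ⟨Nat.succ_le_succ ih.pulls_le, ?_, ?_, hb.1, hb.2, fun _ => hc⟩
      · have := ih.mean_le
        simp only; linarith
      · have := ih.le_mean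
        push_cast
        linarith
    · constructor <;> simp [noiseSum]

/-- The event that the noise over every block of rounds is within its confidence width. -/
def NoiseControlled (T : ℕ) (η : ℕ → ℝ) : Prop :=
  ∀ t ≤ T, ∀ s < t, |noiseSum η s t| ≤ √(10 * Real.log T * ((t - s : ℕ) : ℝ))

lemma NoiseControlled.abs_div_le (hG : NoiseControlled T η) {t n : ℕ} (ht : t ≤ T) (hn : n ≠ 0)
    (hnt : n ≤ t) : |noiseSum η (t - n) t / n| ≤ √(10 * Real.log T / n) := by
  have h := hG t ht (t - n) (by omega)
  rw [Nat.sub_sub_self hnt] at h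
  have hn' : (0 : ℝ) < n := Nat.cast_pos.2 (Nat.pos_of_ne_zero hn)
  rw [abs_div, abs_of_pos hn', div_le_iff₀ hn']
  refine h.trans_eq ?_
  conv_rhs => rw [← Real.sqrt_sq hn'.le, ← Real.sqrt_mul' _ (by positivity)]
  rw [Real.sqrt_sq hn'.le]
  congr 1
  field_simp

/-- Under noise control the regret of a round in which the arm of the previous round is kept is at
most `δ` plus twice the confidence width. -/
lemma RunInvariant.one_sub_mean_le (hG : NoiseControlled T η) {t : ℕ} (ht : t ≤ T) {I : IndexState}
    (h : RunInvariant T ϱ δ u η t I) (hI : I.pulls ≠ 0) :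
    1 - I.mean ≤ δ + 2 * √(10 * Real.log T / I.pulls) := by
  have h1 := h.kept hI
  have h2 := (abs_le.1 (hG.abs_div_le ht hI h.pulls_le)).2
  have hn : (0 : ℝ) < I.pulls := by positivity
  have h3 : I.sum / I.pulls ≤ I.mean + ϱ * I.pulls + noiseSum η (t - I.pulls) t / I.pulls := by
    rw [div_le_iff₀ hn, add_mul, div_mul_cancel₀ _ hn.ne']
    linarith [h.sum_le]
  unfold ucbValue at h1
  linarith

/-- The regret of a round is at most `2 δ` plus the truncated confidence width, where the
truncation level depends on the gap `1 - u k` of the pulled arm. An arm with a gap of at least `2 δ`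
is kept only as long as the width is at least the truncation level. -/
lemma RunInvariant.one_sub_mean_le_truncatedWidth (hG : NoiseControlled T η) (hδ : 0 ≤ δ)
    (hu : ∀ k, 0 ≤ u k) {t : ℕ} (ht : t ≤ T) {I : IndexState}
    (h : RunInvariant T ϱ δ u η t I) :
    1 - I.mean ≤ 2 * δ
      + truncatedWidth (Real.log T) (max (1 - u I.arm - δ) δ) I.pulls := by
  by_cases hI : I.pulls = 0
  · have h1 := h.le_mean
    have h2 := hu I.arm
    simp only [truncatedWidth, hI, if_true, Nat.cast_zero, mul_zero, sub_zero] at h1 ⊢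
    linarith
  · have h1 := h.one_sub_mean_le hG ht hI
    have h2 := h.mean_le
    simp only [truncatedWidth, if_neg hI]
    split_ifs with hc
    · linarith
    · rcases lt_max_iff.1 (not_le.1 hc) with h3 | h3 <;> linarith

/-- The number of arms, among the first `n`, whose initial mean reward is at least `1 - δ / 2`. -/
noncomputable def goodCount (δ : ℝ) (u : ℕ → ℝ) (n : ℕ) : ℝ :=
  ∑ k ∈ Finset.range n, if 1 - δ / 2 ≤ u k then 1 else 0

lemma goodCount_mono (δ : ℝ) (u : ℕ → ℝ) : Monotone (goodCount δ u) := by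
  refine monotone_nat_of_le_succ fun n => ?_
  rw [goodCount, goodCount, Finset.sum_range_succ]
  split_ifs <;> simp

/-- Under noise control an arm with a gap of at most `δ / 2` is discarded only after `n` pulls with
`ϱ * n > δ / 2`, so few such arms are discarded. -/
lemma goodCount_arm_le (hG : NoiseControlled T η) (hρ0 : ∀ t, 1 ≤ t → 0 ≤ ρ t)
    (hρ1 : ∀ t, 1 ≤ t → ρ t ≤ ϱ) (hϱ : 0 ≤ ϱ) {t : ℕ} (ht : t ≤ T) :
    goodCount δ u (indexRun T ϱ δ u ρ η t).arm * (δ / 2)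
      ≤ ϱ * (t - (indexRun T ϱ δ u ρ η t).pulls) := by
  induction t with
  | zero => simp [indexRun, goodCount]
  | succ t ih =>
    have hinv : RunInvariant T ϱ δ u η t (indexRun T ϱ δ u ρ η t) := runInvariant_indexRun hρ0 hρ1 t
    specialize ih (by omega)
    set I := indexRun T ϱ δ u ρ η t with hI
    simp only [indexRun, ← hI]
    split_ifs with hc
    · push_cast
      linarith
    · have hb := (hinv.sum_bounds (hρ1 (t + 1) (Nat.le_add_left 1 t))).1
      have h2 := (abs_le.1 (hG.abs_div_le ht (Nat.succ_ne_zero I.pulls)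
        (Nat.succ_le_succ hinv.pulls_le))).1
      have hn : (0 : ℝ) < ((I.pulls + 1 : ℕ) : ℝ) := by positivity
      rw [← sub_nonneg] at hb
      have hb' := div_nonneg hb hn.le
      rw [sub_div, add_div (_ * _), mul_div_cancel_left₀ _ hn.ne'] at hb'
      rw [not_le, ucbValue] at hc
      have hdisc : u I.arm - ϱ * ((I.pulls + 1 : ℕ) : ℝ) < 1 - δ := by
        simp only [Nat.succ_eq_add_one] at h2
        linarith
      simp only [goodCount, Finset.sum_range_succ] at ih ⊢
      push_cast at hdisc ⊢
      have hle : (I.pulls : ℝ) ≤ t := by exact_mod_cast hinv.pulls_le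
      split_ifs with hg
      · linarith
      · nlinarith

/-- Each discarded arm is charged the bound of `sum_truncatedWidth_le`, and the current arm the
widths of its pulls so far. -/
lemma sum_one_sub_mean_le (hG : NoiseControlled T η) (hρ0 : ∀ t, 1 ≤ t → 0 ≤ ρ t)
    (hρ1 : ∀ t, 1 ≤ t → ρ t ≤ ϱ) (hδ : 0 < δ) (hu : ∀ k, 0 ≤ u k) {t : ℕ} (ht : t ≤ T) :
    ∑ i ∈ Finset.range t, (1 - (indexRun T ϱ δ u ρ η i).mean)
      ≤ 2 * δ * t
        + ∑ k ∈ Finset.range (indexRun T ϱ δ u ρ η t).arm,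
            (1 + 80 * Real.log T / max (1 - u k - δ) δ)
        + ∑ i ∈ Finset.range (indexRun T ϱ δ u ρ η t).pulls,
            truncatedWidth (Real.log T)
              (max (1 - u (indexRun T ϱ δ u ρ η t).arm - δ) δ) i := by
  induction t with
  | zero => simp [indexRun]
  | succ t ih =>
    have hinv : RunInvariant T ϱ δ u η t (indexRun T ϱ δ u ρ η t) := runInvariant_indexRun hρ0 hρ1 t
    have hr := hinv.one_sub_mean_le_truncatedWidth hG hδ.le hu (by omega)
    specialize ih (by omega)
    rw [Finset.sum_range_succ]
    set I := indexRun T ϱ δ u ρ η t with hI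
    simp only [indexRun, ← hI]
    have hlast := sum_truncatedWidth_le (Real.log_natCast_nonneg T)
      (lt_max_of_lt_right hδ : 0 < max (1 - u I.arm - δ) δ) (I.pulls + 1)
    rw [Finset.sum_range_succ] at hlast
    push_cast
    split_ifs with hc
    · rw [Finset.sum_range_succ _ I.pulls]
      linarith
    · rw [Finset.sum_range_succ _ I.arm]
      simp only [Finset.range_zero, Finset.sum_empty]
      linarith

/-- If the noise is controlled and there are enough good arms among the first `K` arms, then only
these `K` arms are pulled, and each of them costs about `log T / (gap + δ)`. -/
lemma sum_one_sub_mean_le_of_goodCount (hG : NoiseControlled T η) (hρ0 : ∀ t, 1 ≤ t → 0 ≤ ρ t)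
    (hρ1 : ∀ t, 1 ≤ t → ρ t ≤ ϱ) (hϱ : 0 ≤ ϱ) (hϱδ : ϱ ≤ δ ^ 3) (hδ : 0 < δ) (hu0 : ∀ k, 0 ≤ u k)
    (hu1 : ∀ k, u k ≤ 1) {K : ℕ} (hK : 2 * T * δ ^ 2 < goodCount δ u K) :
    ∑ i ∈ Finset.range T, (1 - (indexRun T ϱ δ u ρ η i).mean)
      ≤ 2 * δ * T
        + ∑ k ∈ Finset.range K, (1 + 240 * Real.log T * (1 / (1 - u k + δ))) := by
  have hL := Real.log_natCast_nonneg T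
  have h1 := sum_one_sub_mean_le (u := u) hG hρ0 hρ1 hδ hu0 le_rfl
  have h2 := goodCount_arm_le (δ := δ) (u := u) hG hρ0 hρ1 hϱ le_rfl
  set I := indexRun T ϱ δ u ρ η T with hI
  have hlast := sum_truncatedWidth_le (Real.log_natCast_nonneg T)
      (lt_max_of_lt_right hδ : 0 < max (1 - u I.arm - δ) δ) I.pulls
  -- Otherwise more than `2 T δ ^ 2` good arms were discarded, each after more than
  -- `δ / (2 ϱ) ≥ 1 / (2 δ ^ 2)` pulls.
  have harm : I.arm < K := by
    by_contra! hcon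
    have h3 := goodCount_mono δ u hcon
    have h4 : 2 * T * δ ^ 2 * (δ / 2) < goodCount δ u I.arm * (δ / 2) := by
      gcongr
      linarith
    have h5 : ϱ * (T - I.pulls) ≤ δ ^ 3 * T := by
      have : (0 : ℝ) ≤ I.pulls := by positivity
      calc ϱ * (T - I.pulls) ≤ ϱ * T := by gcongr; linarith
        _ ≤ δ ^ 3 * T := by gcongr
    nlinarith
  have hterm : ∀ k, 1 + 80 * Real.log T / max (1 - u k - δ) δ
      ≤ 1 + 240 * Real.log T * (1 / (1 - u k + δ)) := by
    intro k
    have hk := hu1 k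
    have hM : (1 - u k + δ) / 3 ≤ max (1 - u k - δ) δ := by
      rcases le_total (1 - u k) (2 * δ) with h | h
      · exact le_max_of_le_right (by linarith)
      · exact le_max_of_le_left (by linarith)
    have hpos : 0 < (1 - u k + δ) / 3 := by linarith
    calc 1 + 80 * Real.log T / max (1 - u k - δ) δ
        ≤ 1 + 80 * Real.log T / ((1 - u k + δ) / 3) := by gcongr
      _ = 1 + 240 * Real.log T * (1 / (1 - u k + δ)) := by field_simp; ring
  calc _ ≤ 2 * δ * T + ∑ k ∈ Finset.range (I.arm + 1),
            (1 + 80 * Real.log T / max (1 - u k - δ) δ) := by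
        rw [Finset.sum_range_succ]
        linarith
    _ ≤ 2 * δ * T + ∑ k ∈ Finset.range (I.arm + 1),
            (1 + 240 * Real.log T * (1 / (1 - u k + δ))) := by
        gcongr 2 * δ * T + ?_
        exact Finset.sum_le_sum fun k _ => hterm k
    _ ≤ _ := by
        gcongr 2 * δ * T + ?_
        refine Finset.sum_le_sum_of_subset_of_nonneg (by simpa using harm) fun k _ _ => ?_
        have : 0 < 1 - u k + δ := by linarith [hu1 k]
        positivity

/-- A bound on the regret that holds for every noise. The means may become negative, so that a
round can cost more than `1`. -/
lemma sum_one_sub_mean_le_crude (hρ0 : ∀ t, 1 ≤ t → 0 ≤ ρ t) (hρ1 : ∀ t, 1 ≤ t → ρ t ≤ ϱ)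
    (hϱ1 : ϱ ≤ 1) (hT : 1 ≤ T) (hu0 : ∀ k, 0 ≤ u k) :
    ∑ i ∈ Finset.range T, (1 - (indexRun T ϱ δ u ρ η i).mean) ≤ 2 * (T : ℝ) ^ 2 := by
  have hT' : (1 : ℝ) ≤ T := by exact_mod_cast hT
  calc _ ≤ ∑ i ∈ Finset.range T, 2 * (T : ℝ) := by
        refine Finset.sum_le_sum fun i hi => ?_
        have hinv : RunInvariant T ϱ δ u η i (indexRun T ϱ δ u ρ η i) :=
          runInvariant_indexRun hρ0 hρ1 i
        have h1 := hinv.le_mean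
        have h2 := hu0 (indexRun T ϱ δ u ρ η i).arm
        have h3 : ((indexRun T ϱ δ u ρ η i).pulls : ℝ) ≤ T := by
          exact_mod_cast hinv.pulls_le.trans (Finset.mem_range.1 hi).le
        have h4 : ϱ * (indexRun T ϱ δ u ρ η i).pulls ≤ 1 * T := by gcongr
        linarith
    _ = _ := by simp; ring

lemma sum_one_sub_mean_nonneg (hρ0 : ∀ t, 1 ≤ t → 0 ≤ ρ t) (hρ1 : ∀ t, 1 ≤ t → ρ t ≤ ϱ)
    (hu1 : ∀ k, u k ≤ 1) :
    0 ≤ ∑ i ∈ Finset.range T, (1 - (indexRun T ϱ δ u ρ η i).mean) := by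
  refine Finset.sum_nonneg fun i _ => ?_
  have hinv : RunInvariant T ϱ δ u η i (indexRun T ϱ δ u ρ η i) := runInvariant_indexRun hρ0 hρ1 i
  linarith [hinv.mean_le, hu1 (indexRun T ϱ δ u ρ η i).arm]

end Pathwise

section Environment

variable {Ω : Type*} [mΩ : MeasurableSpace Ω] {P : Measure Ω} {𝒜 : Type*} {ϱ : ℝ}
  (E : Environment P 𝒜 ϱ)

/-! ### Concentration of the noise -/

lemma measurable_noiseSum (s t : ℕ) : Measurable[E.ℱ t] fun ω => noiseSum (E.noise · ω) s t := by
  unfold noiseSum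
  refine Finset.measurable_sum _ fun i hi => ?_
  exact (E.measurable_noise (i + 1) (Nat.le_add_left 1 i)).mono
    (E.ℱ.mono (Finset.mem_Ico.1 hi).2) le_rfl

lemma noiseSum_add_one (η : ℕ → ℝ) (s n : ℕ) :
    noiseSum η s (s + (n + 1)) = noiseSum η s (s + n) + η (s + n + 1) := by
  rw [noiseSum, noiseSum, ← add_assoc, Finset.sum_Ico_succ_top (Nat.le_add_right s n)]

lemma integrable_exp_noiseSum [IsProbabilityMeasure P] (s n : ℕ) (l : ℝ) :
    Integrable (fun ω => Real.exp (l * noiseSum (E.noise · ω) s (s + n))) P := by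
  induction n generalizing l with
  | zero => simp [noiseSum]
  | succ n ih =>
    have hint := (ih (2 * l)).add
      (E.integrable_exp_noise (s + n + 1) (Nat.le_add_left 1 _) (2 * l))
    -- `exp (x + y)` is dominated by `exp (2 x) + exp (2 y)`.
    refine hint.mono' ?_ (Eventually.of_forall fun ω => ?_)
    · have := (measurable_noiseSum E s (s + (n + 1))).mono (E.ℱ.le _) le_rfl
      exact (this.const_mul l).exp.aestronglyMeasurable
    · rw [Real.norm_eq_abs, Real.abs_exp, noiseSum_add_one]
      simp only [Pi.add_apply]
      set x := noiseSum (E.noise · ω) s (s + n)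
      set y := E.noise (s + n + 1) ω
      have h1 : Real.exp (l * (x + y)) = Real.exp (l * x) * Real.exp (l * y) := by
        rw [← Real.exp_add]; ring_nf
      have h2 : Real.exp (2 * l * x) = Real.exp (l * x) ^ 2 := by
        rw [← Real.exp_nat_mul]; push_cast; ring_nf
      have h3 : Real.exp (2 * l * y) = Real.exp (l * y) ^ 2 := by
        rw [← Real.exp_nat_mul]; push_cast; ring_nf
      rw [h1, h2, h3]
      nlinarith [sq_nonneg (Real.exp (l * x) - Real.exp (l * y)), sq_nonneg (Real.exp (l * x)),
        sq_nonneg (Real.exp (l * y))]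

/-- The noise over `n` consecutive rounds is sub-Gaussian with variance proxy `n`. -/
lemma mgf_noiseSum_le [IsProbabilityMeasure P] (s n : ℕ) (l : ℝ) :
    mgf (fun ω => noiseSum (E.noise · ω) s (s + n)) P l ≤ Real.exp (n * (l ^ 2 / 2)) := by
  induction n with
  | zero => simp [noiseSum, mgf]
  | succ n ih =>
    set f : Ω → ℝ := fun ω => Real.exp (l * noiseSum (E.noise · ω) s (s + n)) with hf
    set g : Ω → ℝ := fun ω => Real.exp (l * E.noise (s + n + 1) ω) with hg
    have hfg : (fun ω => Real.exp (l * noiseSum (E.noise · ω) s (s + (n + 1)))) = f * g := by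
      funext ω
      rw [noiseSum_add_one, mul_add, Real.exp_add]
      rfl
    have hfi : Integrable f P := integrable_exp_noiseSum E s n l
    have hgi : Integrable g P := E.integrable_exp_noise _ (Nat.le_add_left 1 _) l
    have hfgi : Integrable (f * g) P := hfg ▸ integrable_exp_noiseSum E s (n + 1) l
    have hfm : StronglyMeasurable[E.ℱ (s + n)] f :=
      ((measurable_noiseSum E s (s + n)).const_mul l).exp.stronglyMeasurable
    have hpull := condExp_mul_of_stronglyMeasurable_left hfm hfgi hgi
    have hsub := E.subGaussian_noise (s + n) l
    calc mgf (fun ω => noiseSum (E.noise · ω) s (s + (n + 1))) P l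
        = ∫ ω, (f * g) ω ∂P := by rw [mgf, hfg]
      _ = ∫ ω, (P[f * g | E.ℱ (s + n)]) ω ∂P := (integral_condExp (E.ℱ.le _)).symm
      _ ≤ ∫ ω, f ω * Real.exp (l ^ 2 / 2) ∂P := by
          refine integral_mono_ae integrable_condExp (hfi.mul_const _) ?_
          filter_upwards [hpull, hsub] with ω h1 h2
          rw [h1, Pi.mul_apply]
          exact mul_le_mul_of_nonneg_left h2 (Real.exp_pos _).le
      _ = mgf (fun ω => noiseSum (E.noise · ω) s (s + n)) P l * Real.exp (l ^ 2 / 2) := by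
          rw [integral_mul_const, mgf]
      _ ≤ Real.exp (n * (l ^ 2 / 2)) * Real.exp (l ^ 2 / 2) := by gcongr
      _ = Real.exp ((n + 1 : ℕ) * (l ^ 2 / 2)) := by
          rw [← Real.exp_add]; push_cast; ring_nf

/-- Chernoff's bound for both tails. The optimal exponent `ε / n` gives `exp (-ε ^ 2 / (2 n))`, which
is `T ^ (-5)`. -/
lemma measureReal_noiseSum_gt_le [IsProbabilityMeasure P] {T : ℕ} (hT : 1 ≤ T) (s n : ℕ)
    (hn : n ≠ 0) :
    P.real {ω | √(10 * Real.log T * n) < |noiseSum (E.noise · ω) s (s + n)|}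
      ≤ 2 / (T : ℝ) ^ 5 := by
  have hn' : (0 : ℝ) < n := by positivity
  have hT' : (0 : ℝ) < T := by exact_mod_cast hT
  have hL := Real.log_natCast_nonneg T
  set ε := √(10 * Real.log T * n) with hε
  have hε0 : 0 ≤ ε := Real.sqrt_nonneg _
  have hεsq : ε ^ 2 = 10 * Real.log T * n := Real.sq_sqrt (by positivity)
  have hval : ∀ l : ℝ, l ^ 2 = (ε / n) ^ 2 →
      Real.exp (-(ε / n) * ε) * Real.exp (n * (l ^ 2 / 2)) = 1 / (T : ℝ) ^ 5 := by
    intro l hl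
    rw [← Real.exp_add, hl]
    have : -(ε / n) * ε + n * ((ε / n) ^ 2 / 2) = -(5 * Real.log T) := by
      field_simp
      rw [hεsq]
      ring
    rw [this, Real.exp_neg, show 5 * Real.log T = ((5 : ℕ) : ℝ) * Real.log T by norm_num,
      Real.exp_nat_mul, Real.exp_log hT', one_div]
  have hup := (measure_ge_le_exp_mul_mgf (μ := P)
    (X := fun ω => noiseSum (E.noise · ω) s (s + n)) ε (t := ε / n) (by positivity)
    (integrable_exp_noiseSum E s n _)).trans (mul_le_mul_of_nonneg_left
      (mgf_noiseSum_le E s n _) (Real.exp_pos _).le)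
  have hlow := (measure_le_le_exp_mul_mgf (μ := P)
    (X := fun ω => noiseSum (E.noise · ω) s (s + n)) (-ε) (t := -(ε / n))
    (neg_nonpos.2 (by positivity))
    (integrable_exp_noiseSum E s n _)).trans (mul_le_mul_of_nonneg_left
      (mgf_noiseSum_le E s n _) (Real.exp_pos _).le)
  rw [hval _ rfl] at hup
  rw [show -(-(ε / n)) * -ε = -(ε / n) * ε by ring, hval _ (neg_sq _)] at hlow
  calc _ ≤ P.real ({ω | ε ≤ noiseSum (E.noise · ω) s (s + n)}
        ∪ {ω | noiseSum (E.noise · ω) s (s + n) ≤ -ε}) := by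
        refine measureReal_mono fun ω hω => ?_
        have hω' : ε < |noiseSum (E.noise · ω) s (s + n)| := hω
        rcases lt_abs.1 hω' with h | h
        · exact Or.inl h.le
        · exact Or.inr (le_neg_of_le_neg h.le)
    _ ≤ _ := (measureReal_union_le _ _).trans (
        (add_le_add hup hlow).trans_eq (by ring))

/-- A union bound over the `T ^ 2` blocks of rounds. -/
lemma measureReal_not_noiseControlled_le [IsProbabilityMeasure P] {T : ℕ} (hT : 1 ≤ T) :
    P.real {ω | ¬ NoiseControlled T (E.noise · ω)} ≤ 2 / (T : ℝ) ^ 2 := by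
  have hT' : (1 : ℝ) ≤ T := by exact_mod_cast hT
  set A : ℕ × ℕ → Set Ω := fun p =>
    {ω | √(10 * Real.log T * ((p.2 + 1 : ℕ) : ℝ))
      < |noiseSum (E.noise · ω) p.1 (p.1 + (p.2 + 1))|} with hA
  calc _ ≤ P.real (⋃ p ∈ Finset.range T ×ˢ Finset.range T, A p) := by
        refine measureReal_mono (fun ω hω => ?_) (measure_ne_top P _)
        simp only [NoiseControlled, Set.mem_ofPred_eq, not_forall, not_le] at hω
        obtain ⟨t, ht, s, hs, h⟩ := hω
        obtain ⟨d, rfl⟩ := Nat.exists_eq_add_of_lt hs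
        simp only [Set.mem_iUnion]
        refine ⟨(s, d), by simp; omega, ?_⟩
        rw [show s + d + 1 - s = d + 1 by omega] at h
        exact h
    _ ≤ ∑ p ∈ Finset.range T ×ˢ Finset.range T, P.real (A p) := measureReal_biUnion_finset_le _ _
    _ ≤ ∑ p ∈ Finset.range T ×ˢ Finset.range T, 2 / (T : ℝ) ^ 5 :=
        Finset.sum_le_sum fun p _ => measureReal_noiseSum_gt_le E hT _ _ (Nat.succ_ne_zero _)
    _ = 2 / (T : ℝ) ^ 3 := by
        simp only [Finset.sum_const, Finset.card_product, Finset.card_range, nsmul_eq_mul]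
        push_cast
        field_simp
    _ ≤ 2 / (T : ℝ) ^ 2 := by gcongr; norm_num

/-! ### The initial mean rewards -/

/-- Measurability for the ambient σ-algebra instead of `ℱ 0`. -/
lemma measurable_initialMean_ambient (a : 𝒜) : Measurable (E.initialMean a) :=
  (E.measurable_initialMean a).mono (E.ℱ.le 0) le_rfl

/-- The conditional measure of `pdf.IsUniform` needs no normalization, as the interval has length
`1`. -/
lemma map_initialMean (a : 𝒜) :
    P.map (E.initialMean a) = volume.restrict (Set.Icc (0 : ℝ) 1) := by
  have h : P.map (E.initialMean a) = ProbabilityTheory.cond volume (Set.Icc (0 : ℝ) 1) :=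
    E.uniform_initialMean a
  rw [h, ProbabilityTheory.cond]
  simp

lemma ae_initialMean_mem (a : 𝒜) : ∀ᵐ ω ∂P, E.initialMean a ω ∈ Set.Icc (0 : ℝ) 1 := by
  refine ae_of_ae_map (measurable_initialMean_ambient E a).aemeasurable ?_
  rw [map_initialMean]
  exact ae_restrict_mem measurableSet_Icc

lemma measureReal_initialMean_ge (a : 𝒜) {x : ℝ} (hx0 : 0 ≤ x) (hx1 : x ≤ 1) :
    P.real {ω | 1 - x ≤ E.initialMean a ω} = x := by
  have h : P.real {ω | 1 - x ≤ E.initialMean a ω}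
      = (P.map (E.initialMean a)).real (Set.Ici (1 - x)) := by
    rw [map_measureReal_apply (measurable_initialMean_ambient E a) measurableSet_Ici]
    rfl
  rw [h, map_initialMean, measureReal_restrict_apply measurableSet_Ici]
  have : Set.Ici (1 - x) ∩ Set.Icc (0 : ℝ) 1 = Set.Icc (1 - x) 1 := by
    ext y
    simp only [Set.mem_inter_iff, Set.mem_Ici, Set.mem_Icc]
    constructor
    · rintro ⟨h1, h2, h3⟩; exact ⟨h1, h3⟩
    · rintro ⟨h1, h2⟩; exact ⟨h1, by linarith, h2⟩
  rw [this, Real.volume_real_Icc_of_le (by linarith)]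
  ring

lemma integral_one_div_gap (a : 𝒜) {δ : ℝ} (hδ : 0 < δ) :
    ∫ ω, 1 / (1 - E.initialMean a ω + δ) ∂P = Real.log ((1 + δ) / δ) := by
  have hmeas : Measurable fun x : ℝ => 1 / (1 - x + δ) := by fun_prop
  calc ∫ ω, 1 / (1 - E.initialMean a ω + δ) ∂P
      = ∫ x, 1 / (1 - x + δ) ∂(P.map (E.initialMean a)) := by
        rw [integral_map (measurable_initialMean_ambient E a).aemeasurable hmeas.aestronglyMeasurable]
    _ = ∫ x in (0 : ℝ)..1, 1 / (1 - x + δ) := by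
        rw [map_initialMean, intervalIntegral.integral_of_le zero_le_one,
          integral_Icc_eq_integral_Ioc]
    _ = ∫ x in (0 : ℝ)..1, (fun y => 1 / y) (1 + δ - x) := by
        congr 1
        funext x
        ring_nf
    _ = Real.log ((1 + δ) / δ) := by
        rw [intervalIntegral.integral_comp_sub_left (fun y => 1 / y) (1 + δ)]
        rw [show 1 + δ - 1 = δ by ring, sub_zero, integral_one_div_of_pos hδ (by linarith)]

lemma integrable_one_div_gap [IsProbabilityMeasure P] (a : 𝒜) {δ : ℝ} (hδ : 0 < δ) :
    Integrable (fun ω => 1 / (1 - E.initialMean a ω + δ)) P := by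
  have hm := measurable_initialMean_ambient E a
  refine (integrable_const (1 / δ)).mono'
    (measurable_const.div ((hm.const_sub 1).add_const δ)).aestronglyMeasurable ?_
  filter_upwards [ae_initialMean_mem E a] with ω hω
  have h : δ ≤ 1 - E.initialMean a ω + δ := by linarith [hω.2]
  rw [Real.norm_of_nonneg (one_div_nonneg.2 (hδ.le.trans h))]
  exact one_div_le_one_div_of_le hδ h

/-- Chernoff's bound for the number of good arms among the first `K` arms, a binomial random
variable with parameters `K` and `δ / 2`. -/
lemma measureReal_goodCount_le [IsProbabilityMeasure P] {b : ℕ → 𝒜} (hb : Function.Injective b)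
    {δ : ℝ} (hδ0 : 0 ≤ δ) (hδ1 : δ ≤ 1) (K : ℕ) (m : ℝ) :
    P.real {ω | goodCount δ (fun k => E.initialMean (b k) ω) K ≤ m}
      ≤ Real.exp (m - K * (δ / 4)) := by
  set g : ℝ → ℝ := fun x => if 1 - δ / 2 ≤ x then 1 else 0 with hg
  have hgm : Measurable g := Measurable.ite measurableSet_Ici measurable_const measurable_const
  set X : ℕ → Ω → ℝ := fun k => g ∘ E.initialMean (b k) with hX
  have hXm : ∀ k, Measurable (X k) := fun k => hgm.comp (measurable_initialMean_ambient E (b k))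
  have hindep : iIndepFun X P :=
    (E.indep_initialMean.precomp hb).comp (fun _ => g) fun _ => hgm
  have hsum : (fun ω => goodCount δ (fun k => E.initialMean (b k) ω) K)
      = ∑ k ∈ Finset.range K, X k := by
    funext ω
    simp [goodCount, hX, hg]
  have hX0 : ∀ k ω, 0 ≤ X k ω := fun k ω => by
    simp only [hX, hg, Function.comp_apply]; split_ifs <;> norm_num
  have hmgf : ∀ k, mgf (X k) P (-1) ≤ Real.exp (-(δ / 4)) := by
    intro k
    have hA : MeasurableSet {ω | 1 - δ / 2 ≤ E.initialMean (b k) ω} :=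
      measurableSet_le measurable_const (measurable_initialMean_ambient E (b k))
    have hXind : X k = {ω | 1 - δ / 2 ≤ E.initialMean (b k) ω}.indicator fun _ => (1 : ℝ) := by
      funext ω
      simp [hX, hg, Set.indicator_apply]
    have hXi : Integrable (X k) P := hXind ▸ (integrable_const 1).indicator hA
    calc mgf (X k) P (-1) ≤ ∫ ω, (1 - 1 / 2 * X k ω) ∂P := by
          refine integral_mono_of_nonneg (Eventually.of_forall fun _ => (Real.exp_pos _).le)
            ((integrable_const 1).sub (hXi.const_mul _)) (Eventually.of_forall fun ω => ?_)
          simp only [hX, hg, Function.comp_apply]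
          split_ifs
          · have := Real.exp_neg_one_lt_half
            norm_num at this ⊢
            exact this.le
          · simp
      _ = 1 - δ / 4 := by
          rw [integral_sub (integrable_const 1) (hXi.const_mul _), integral_const_mul, hXind,
            integral_indicator_const _ hA,
            measureReal_initialMean_ge E (b k) (by linarith) (by linarith)]
          simp
          ring
      _ ≤ Real.exp (-(δ / 4)) := by linarith [Real.add_one_le_exp (-(δ / 4))]
  have hint : Integrable (fun ω => Real.exp (-1 * (∑ k ∈ Finset.range K, X k) ω)) P := by
    have hm : Measurable (∑ k ∈ Finset.range K, X k) := by
      rw [Finset.sum_fn]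
      exact Finset.measurable_sum _ fun k _ => hXm k
    refine (integrable_const (1 : ℝ)).mono' (hm.const_mul _).exp.aestronglyMeasurable
      (Eventually.of_forall fun ω => ?_)
    rw [Real.norm_eq_abs, Real.abs_exp, Real.exp_le_one_iff, Finset.sum_apply]
    linarith [Finset.sum_nonneg fun k (_ : k ∈ Finset.range K) => hX0 k ω]
  have hch := measure_le_le_exp_mul_mgf (μ := P) m (by norm_num : (-1 : ℝ) ≤ 0) hint
  rw [hindep.mgf_sum hXm] at hch
  calc _ = P.real {ω | (∑ k ∈ Finset.range K, X k) ω ≤ m} := by rw [← hsum]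
    _ ≤ Real.exp (- -1 * m) * ∏ k ∈ Finset.range K, mgf (X k) P (-1) := hch
    _ ≤ Real.exp (- -1 * m) * ∏ k ∈ Finset.range K, Real.exp (-(δ / 4)) := by
        gcongr with k _
        · exact fun k _ => mgf_nonneg
        · exact hmgf k
    _ = Real.exp (m - K * (δ / 4)) := by
        rw [Finset.prod_const, Finset.card_range, ← Real.exp_nat_mul, ← Real.exp_add]
        ring_nf

end Environment

/-! ### The expected regret -/

section Threshold

variable {T : ℕ} {ϱ : ℝ}

lemma threshold_pos (hT : 1 ≤ T) : 0 < threshold T ϱ :=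
  lt_max_of_lt_right (one_div_pos.2 (Real.sqrt_pos.2 (by exact_mod_cast hT)))

lemma threshold_le_one (hT : 1 ≤ T) (hϱ0 : 0 ≤ ϱ) (hϱ1 : ϱ ≤ 1) : threshold T ϱ ≤ 1 := by
  refine max_le (Real.rpow_le_one hϱ0 hϱ1 (by norm_num)) ?_
  have h : (1 : ℝ) ≤ √(T : ℝ) := Real.one_le_sqrt.2 (by exact_mod_cast hT)
  exact (div_le_one (by linarith)).2 h

lemma le_threshold_pow_three (hϱ : 0 ≤ ϱ) : ϱ ≤ threshold T ϱ ^ 3 := by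
  calc ϱ = (ϱ ^ (1 / 3 : ℝ)) ^ 3 := by
        rw [← Real.rpow_natCast, ← Real.rpow_mul hϱ]; norm_num
    _ ≤ threshold T ϱ ^ 3 := pow_le_pow_left₀ (Real.rpow_nonneg hϱ _) (le_max_left _ _) 3

lemma one_div_threshold_le (hT : 1 ≤ T) : 1 / threshold T ϱ ≤ √(T : ℝ) := by
  have h : 0 < √(T : ℝ) := Real.sqrt_pos.2 (by exact_mod_cast hT)
  rw [one_div_le (threshold_pos hT) h]
  exact le_max_right _ _

lemma threshold_mul : threshold T ϱ * T = max (ϱ ^ (1 / 3 : ℝ) * T) (√(T : ℝ)) := by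
  rw [threshold, max_mul_of_nonneg _ _ (Nat.cast_nonneg T), one_div_mul_eq_div, Real.div_sqrt]

end Threshold

section ExpectedRegret

variable {Ω : Type*} [mΩ : MeasurableSpace Ω] {P : Measure Ω} [IsProbabilityMeasure P]
  {𝒜 : Type*} {ϱ : ℝ}

/-- The expected regret in terms of the number `K` of arms that are considered: `K` enters the main
term linearly, and has to be so large that too few good arms among the first `K` are unlikely. -/
lemma ucbThresholdRegret_bound (E : Environment P 𝒜 ϱ) {select : Finset 𝒜 → 𝒜}
    (hsel : ∀ D, select D ∉ D) {T : ℕ} (hT : 1 ≤ T) (hϱ0 : 0 ≤ ϱ) (hϱ1 : ϱ ≤ 1) {δ : ℝ}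
    (hδ : δ = threshold T ϱ) (K : ℕ) :
    Integrable (ucbThresholdRegret E select T) P ∧
      ∫ ω, ucbThresholdRegret E select T ω ∂P
        ≤ 2 * δ * T + K * (1 + 240 * Real.log T * Real.log ((1 + δ) / δ))
          + 2 * (T : ℝ) ^ 2 * (2 / (T : ℝ) ^ 2 + Real.exp (2 * T * δ ^ 2 - K * (δ / 4))) := by
  have hδ0 : 0 < δ := hδ ▸ threshold_pos hT
  have hδ1 : δ ≤ 1 := hδ ▸ threshold_le_one hT hϱ0 hϱ1
  have hϱδ : ϱ ≤ δ ^ 3 := hδ ▸ le_threshold_pow_three hϱ0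
  set b := selectedArm select with hb
  set u : ℕ → Ω → ℝ := fun k => E.initialMean (b k) with hu
  set R := ucbThresholdRegret E select T with hR
  have hRsum : ∀ ω, R ω = ∑ t ∈ Finset.range T,
      (1 - (indexRun T ϱ δ (u · ω) (E.rotting · ω) (E.noise · ω) t).mean) := fun ω => by
    rw [hR, ucbThresholdRegret, ← hδ, regret_eq_sum_indexRun hsel]
  have hmeas : Measurable R := by
    rw [funext hRsum]
    refine Finset.measurable_sum _ fun t _ => measurable_const.sub ?_
    exact (measurable_indexRun T ϱ δ (fun k => measurable_initialMean_ambient E (b k))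
      (fun t ht => (E.measurable_rotting t ht).mono (E.ℱ.le t) le_rfl)
      (fun t ht => (E.measurable_noise t ht).mono (E.ℱ.le t) le_rfl) t).2.2.2
  set bad : Set Ω := {ω | ¬ NoiseControlled T (E.noise · ω)}
    ∪ {ω | goodCount δ (u · ω) K ≤ 2 * T * δ ^ 2} with hbad
  -- The measurable hull spares a proof that `bad` is measurable.
  set B := toMeasurable P bad with hB
  have hBm : MeasurableSet B := measurableSet_toMeasurable P bad
  have hPB : P.real B ≤ 2 / (T : ℝ) ^ 2 + Real.exp (2 * T * δ ^ 2 - K * (δ / 4)) := by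
    have h1 : P.real B = P.real bad := by
      rw [measureReal_def, measureReal_def, hB, measure_toMeasurable]
    rw [h1]
    exact (measureReal_union_le _ _).trans (add_le_add (measureReal_not_noiseControlled_le E hT)
      (measureReal_goodCount_le E (selectedArm_injective hsel) hδ0.le hδ1 K _))
  set S : Ω → ℝ := fun ω => ∑ k ∈ Finset.range K, (1 + 240 * Real.log T * (1 / (1 - u k ω + δ)))
    with hS
  have hterm : ∀ k, Integrable (fun ω => 1 + 240 * Real.log T * (1 / (1 - u k ω + δ))) P :=
    fun k => (integrable_const 1).add ((integrable_one_div_gap E (b k) hδ0).const_mul _)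
  have hSi : Integrable S P := integrable_finsetSum _ fun k _ => hterm k
  have hIi : Integrable (B.indicator fun _ => 2 * (T : ℝ) ^ 2) P :=
    (integrable_const _).indicator hBm
  have hAi : Integrable (fun ω => 2 * δ * T + S ω) P := (integrable_const _).add hSi
  have hFi : Integrable (fun ω => 2 * δ * T + S ω + B.indicator (fun _ => 2 * (T : ℝ) ^ 2) ω) P :=
    hAi.add hIi
  have hu01 : ∀ᵐ ω ∂P, ∀ k, u k ω ∈ Set.Icc (0 : ℝ) 1 :=
    ae_all_iff.2 fun k => ae_initialMean_mem E (b k)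
  have hR0 : ∀ᵐ ω ∂P, 0 ≤ R ω := by
    filter_upwards [hu01] with ω hω
    rw [hRsum]
    exact sum_one_sub_mean_nonneg (fun t ht => E.rotting_nonneg t ht ω)
      (fun t ht => E.rotting_le t ht ω) fun k => (hω k).2
  have hRF : ∀ᵐ ω ∂P, R ω ≤ 2 * δ * T + S ω + B.indicator (fun _ => 2 * (T : ℝ) ^ 2) ω := by
    filter_upwards [hu01] with ω hω
    rw [hRsum]
    have hρ0 : ∀ t, 1 ≤ t → 0 ≤ E.rotting t ω := fun t ht => E.rotting_nonneg t ht ω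
    have hρ1 : ∀ t, 1 ≤ t → E.rotting t ω ≤ ϱ := fun t ht => E.rotting_le t ht ω
    by_cases hωB : ω ∈ B
    · rw [Set.indicator_of_mem hωB]
      have h1 := sum_one_sub_mean_le_crude (T := T) (δ := δ) (u := (u · ω)) (η := (E.noise · ω))
        hρ0 hρ1 hϱ1 hT fun k => (hω k).1
      have h2 : 0 ≤ S ω := Finset.sum_nonneg fun k _ => by
        have h3 := Real.log_natCast_nonneg T
        have h4 : 0 < 1 - u k ω + δ := by linarith [(hω k).2]
        positivity
      have h5 : 0 ≤ 2 * δ * T := by positivity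
      linarith
    · rw [Set.indicator_of_notMem hωB, add_zero]
      have hgood : ω ∉ bad := fun h => hωB (subset_toMeasurable P bad h)
      have hG : NoiseControlled T (E.noise · ω) := by
        by_contra h
        exact hgood (Or.inl h)
      have hK : 2 * T * δ ^ 2 < goodCount δ (u · ω) K := by
        by_contra! h
        exact hgood (Or.inr h)
      exact sum_one_sub_mean_le_of_goodCount hG hρ0 hρ1 hϱ0 hϱδ hδ0 (fun k => (hω k).1)
        (fun k => (hω k).2) hK
  have hint : Integrable R P := by
    refine hFi.mono' hmeas.aestronglyMeasurable ?_
    filter_upwards [hR0, hRF] with ω h0 h1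
    rwa [Real.norm_of_nonneg h0]
  refine ⟨hint, (integral_mono_ae hint hFi hRF).trans ?_⟩
  rw [integral_add hAi hIi, integral_add (integrable_const _) hSi,
    integral_finsetSum _ fun k _ => hterm k, integral_indicator_const _ hBm]
  have hE : ∀ k, ∫ ω, (1 + 240 * Real.log T * (1 / (1 - u k ω + δ))) ∂P
      = 1 + 240 * Real.log T * Real.log ((1 + δ) / δ) := fun k => by
    rw [integral_add (integrable_const 1) ((integrable_one_div_gap E (b k) hδ0).const_mul _),
      integral_const_mul, integral_one_div_gap E (b k) hδ0]
    simp
  simp only [hE, integral_const, probReal_univ, one_mul, Finset.sum_const, Finset.card_range,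
    nsmul_eq_mul, smul_eq_mul]
  rw [mul_comm (P.real B)]
  gcongr

/-- With `K` of order `δ T log T` the failure probability is of order `1 / T ^ 2`. -/
lemma ucbThresholdRegret_le (E : Environment P 𝒜 ϱ) {select : Finset 𝒜 → 𝒜}
    (hsel : ∀ D, select D ∉ D) {T : ℕ} (hT : 4 ≤ T) (hϱ0 : 0 ≤ ϱ) (hϱ1 : ϱ ≤ 1) :
    Integrable (ucbThresholdRegret E select T) P ∧
      ∫ ω, ucbThresholdRegret E select T ω ∂P
        ≤ 5000 * Real.log T ^ 3 * max (ϱ ^ (1 / 3 : ℝ) * T) (√(T : ℝ)) := by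
  have hT1 : 1 ≤ T := by omega
  have hT' : (4 : ℝ) ≤ T := by exact_mod_cast hT
  rw [← threshold_mul]
  set δ := threshold T ϱ with hδ
  set L := Real.log T with hL
  have hδ0 : 0 < δ := threshold_pos hT1
  have hδ1 : δ ≤ 1 := threshold_le_one hT1 hϱ0 hϱ1
  have hinv : 1 / δ ≤ √(T : ℝ) := one_div_threshold_le hT1
  have hsqrt : √(T : ℝ) ≤ δ * T := by
    rw [threshold_mul]
    exact le_max_right _ _
  have hsq : √(T : ℝ) ^ 2 = T := Real.sq_sqrt (by linarith)
  have hsqrt2 : 2 ≤ √(T : ℝ) := Real.le_sqrt_of_sq_le (by linarith)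
  have hL1 : 1 ≤ L := by
    rw [hL, Real.le_log_iff_exp_le (by linarith)]
    linarith [Real.exp_one_lt_d9]
  have hlog0 : 0 ≤ Real.log ((1 + δ) / δ) :=
    Real.log_nonneg ((one_le_div hδ0).2 (by linarith))
  have hlog : Real.log ((1 + δ) / δ) ≤ L := by
    refine Real.log_le_log (by positivity) ?_
    calc (1 + δ) / δ ≤ 2 / δ := by gcongr; linarith
      _ = 2 * (1 / δ) := by ring
      _ ≤ √(T : ℝ) * √(T : ℝ) := by gcongr
      _ = T := by rw [← sq, hsq]
  -- `K * δ / 4` exceeds the threshold `2 T δ ^ 2` of `ucbThresholdRegret_bound` by `2 log T`.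
  set K := ⌈4 / δ * (2 * T * δ ^ 2 + 2 * L)⌉₊ with hK
  obtain ⟨hint, hbound⟩ := ucbThresholdRegret_bound E hsel hT1 hϱ0 hϱ1 hδ K
  refine ⟨hint, hbound.trans ?_⟩
  have hKle : (K : ℝ) ≤ 17 * L * (δ * T) := by
    have h1 : (K : ℝ) ≤ 4 / δ * (2 * T * δ ^ 2 + 2 * L) + 1 :=
      (Nat.ceil_lt_add_one (by positivity)).le
    have h2 : 4 / δ * (2 * T * δ ^ 2 + 2 * L) = 8 * (δ * T) + 8 * L * (1 / δ) := by
      field_simp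
      ring
    have h3 : 8 * L * (1 / δ) ≤ 8 * L * (δ * T) := by gcongr; exact hinv.trans hsqrt
    have h4 : 1 * (δ * T) ≤ L * (δ * T) := by gcongr
    linarith
  have hexp : Real.exp (2 * T * δ ^ 2 - K * (δ / 4)) ≤ 1 / (T : ℝ) ^ 2 := by
    have h1 : 2 * T * δ ^ 2 + 2 * L ≤ K * (δ / 4) := by
      calc 2 * T * δ ^ 2 + 2 * L = 4 / δ * (2 * T * δ ^ 2 + 2 * L) * (δ / 4) := by field_simp
        _ ≤ K * (δ / 4) := by gcongr; exact Nat.le_ceil _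
    calc Real.exp (2 * T * δ ^ 2 - K * (δ / 4)) ≤ Real.exp (-(((2 : ℕ) : ℝ) * L)) := by
          rw [Real.exp_le_exp]; push_cast; linarith
      _ = 1 / (T : ℝ) ^ 2 := by
          rw [Real.exp_neg, Real.exp_nat_mul, hL, Real.exp_log (by linarith), one_div]
  calc _ ≤ 2 * δ * T + 17 * L * (δ * T) * (1 + 240 * L * L)
          + 2 * (T : ℝ) ^ 2 * (2 / (T : ℝ) ^ 2 + 1 / (T : ℝ) ^ 2) := by gcongr
    _ = 2 * (δ * T) + 17 * (δ * T) * L + 4080 * (δ * T) * L ^ 3 + 6 := by field_simp; ring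
    _ ≤ 2 * (δ * T) * L ^ 3 + 17 * (δ * T) * L ^ 3 + 4080 * (δ * T) * L ^ 3
          + 6 * (δ * T) * L ^ 3 := by
        have h1 : 1 ≤ L ^ 3 := one_le_pow₀ hL1
        have h2 : L ≤ L ^ 3 := le_self_pow₀ hL1 (by norm_num)
        have h3 : 1 ≤ δ * T := by linarith
        have h4 : 1 * 1 ≤ (δ * T) * L ^ 3 := by gcongr
        have h5 : 2 * (δ * T) * 1 ≤ 2 * (δ * T) * L ^ 3 := by gcongr
        have h6 : 17 * (δ * T) * L ≤ 17 * (δ * T) * L ^ 3 := by gcongr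
        linarith
    _ ≤ 5000 * L ^ 3 * (δ * T) := by
        have : 0 ≤ L ^ 3 * (δ * T) := by positivity
        linarith

end ExpectedRegret

end RottingBandits

theorem theorem2 :
    ∃ C : ℝ, 0 < C ∧ ∃ k : ℕ,
      ∀ ϱ : ℕ → ℝ, (∀ T, 0 ≤ ϱ T) → Tendsto ϱ atTop (𝓝 0) →
        ∀ᶠ T : ℕ in atTop,
          ∀ (𝒜 : Type*) (_ : Infinite 𝒜) (select : Finset 𝒜 → 𝒜) (_ : ∀ D, select D ∉ D)
            (Ω : Type*) (_ : MeasurableSpace Ω) (P : Measure Ω) (_ : IsProbabilityMeasure P)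
            (E : RottingBandits.Environment P 𝒜 (ϱ T)),
            Integrable (RottingBandits.ucbThresholdRegret E select T) P ∧
              ∫ ω, RottingBandits.ucbThresholdRegret E select T ω ∂P
                ≤ C * Real.log (T : ℝ) ^ k
                    * max ((ϱ T) ^ (1 / 3 : ℝ) * (T : ℝ)) (√(T : ℝ)) := by
  refine ⟨5000, by norm_num, 3, fun ϱ hϱ0 hϱ => ?_⟩
  filter_upwards [hϱ.eventually_le_const one_pos, eventually_ge_atTop 4] with T hϱ1 hT
  intro 𝒜 _ select hsel Ω _ P _ E
  exact RottingBandits.ucbThresholdRegret_le E hsel hT (hϱ0 T) hϱ1
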